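/- **Setting.** Let $\mathcal X\subset\mathbb R$ be an interval and let $(F_x)_{x\in\mathcal X}$ be a family of distribution functions on $\mathbb R$ such that $x\mapsto F_x(y)$ is non-increasing on $\mathcal X$ for every $y\in\mathbb R$. For each $n\ge 2$ let $(X_{n1},Y_{n1}),\dots,(X_{nn},Y_{nn})$ be random pairs with $X_{ni}\in\mathcal X$ (random or fixed) such that, conditionally on $\boldsymbol X_n=(X_{n1},\dots,X_{nn})$, the $Y_{n1},\dots,Y_{nn}$ are independent with $\mathbb P(Y_{ni}\le y\mid\boldsymbol X_n)=F_{X_{ni}}(y)$ for all $i$ and $y$. **Estimator.** Let $x_1<\dots<x_m$ be the distinct values among $X_{n1},\dots,X_{nn}$, let $w_j=\#\{i:X_{ni}=x_j\}$ and $\widehat{\mathbb F}_j(y)=w_j^{-1}\#\{i:X_{ni}=x_j,\,Y_{ni}\le y\}$. For each $y$, the vector $(\widehat F_{nx_j}(y))_{j=1}^m$ is the minimizer of $\sum_{j=1}^m w_j(\widehat{\mathbb F}_j(y)-f_j)^2$ over all $f_1\ge f_2\ge\dots\ge f_m$. It is extended to a non-increasing function $x\mapsto\widehat F_{nx}(y)$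 on $\mathcal X$ by $\widehat F_{nx}(y)=\widehat F_{nx_1}(y)$ for $x\le x_1$, $\widehat F_{nx}(y)=\widehat F_{nx_m}(y)$ for $x\ge x_m$, and an arbitrary non-increasing interpolation between consecutive $x_j$'s. **Assumptions.** Let $I\subset\mathcal X$ and $J\subset\mathbb R$ be intervals, $\alpha\in(0,1]$, $C_1,C_2,C_3>0$, and put $\rho_n=\log(n)/n$ and $\delta_n=C_3\,\rho_n^{1/(2\alpha+1)}$. Let $\lambda$ denote Lebesgue measure. (A.1) $\sup_{y\in J}|F_w(y)-F_x(y)|\le C_1|w-x|^\alpha$ for all $w,x\in I$. (A.2) $\mathbb P(A_n)\to1$ as $n\to\infty$, where $A_n$ is the event that $$\frac{\#\{i\le n:X_{ni}\in S\}}{n\,\lambda(S)}\ \ge\ C_2\quad\text{for all intervals } S\subset I \text{ with } \lambda(S)\ge\delta_n .$$ **Theorem.** There is a constant $C>0$ depending only on $C_1,C_2,C_3$ such that, whenever (A.1) and (A.2) hold, $$\lim_{n\to\infty}\mathbb P\Bigl(\sup_{x\in I_n,\,y\in J}\bigl|\widehat F_{nx}(y)-F_x(y)\bigr|\ \ge\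 C\,\rho_n^{\alpha/(2\alpha+1)}\Bigr)=0,$$ where $I_n=\{x\in\mathbb R:[x-\delta_n,x+\delta_n]\subset I\}$ (a supremum over the empty set being $0$). -/

import Mathlib

open MeasureTheory ProbabilityTheory Filter Topology
open scoped ENNReal

noncomputable section

namespace MonotoneLS

/-- `G` is a (cumulative) distribution function on the real line. -/
structure IsDistributionFunction (G : ℝ → ℝ) : Prop where
  mono : Monotone G
  right_cts : ∀ y, ContinuousWithinAt G (Set.Ici y) y
  tendsto_atBot : Tendsto G atBot (𝓝 0)
  tendsto_atTop : Tendsto G atTop (𝓝 1)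

/-- A family of distribution functions `F x`, `x ∈ 𝒳`, which is isotonic in `x` with respect to
stochastic order. -/
structure IsStochIsotonicFamily (𝒳 : Set ℝ) (F : ℝ → ℝ → ℝ) : Prop where
  isDistributionFunction : ∀ x ∈ 𝒳, IsDistributionFunction (F x)
  antitone : ∀ y, AntitoneOn (fun x => F x y) 𝒳

/-- The σ-algebra generated by the covariate vector `X = (X 1, …, X n)`. -/
abbrev covariateSigma {Ω : Type*} {n : ℕ} (X : Fin n → Ω → ℝ) : MeasurableSpace Ω :=
  MeasurableSpace.comap (fun ω i => X i ω) inferInstance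

/-- The model for one sample of size `n`: covariates in `𝒳` (random or fixed), and, conditionally
on the covariate vector, independent responses `Y i` with distribution functions `F (X i)`. -/
structure IsSample {Ω : Type*} [MeasurableSpace Ω] (P : Measure Ω) (𝒳 : Set ℝ) (F : ℝ → ℝ → ℝ)
    {n : ℕ} (X Y : Fin n → Ω → ℝ) : Prop where
  measurable_X : ∀ i, Measurable (X i)
  measurable_Y : ∀ i, Measurable (Y i)
  mem : ∀ i ω, X i ω ∈ 𝒳
  condIndep : ∀ B : Fin n → Set ℝ, (∀ i, MeasurableSet (B i)) →
    P⟦⋂ i, Y i ⁻¹' B i | covariateSigma X⟧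
      =ᵐ[P] fun ω => ∏ i, (P⟦Y i ⁻¹' B i | covariateSigma X⟧) ω
  condCdf : ∀ (i : Fin n) (y : ℝ),
    P⟦{ω | Y i ω ≤ y} | covariateSigma X⟧ =ᵐ[P] fun ω => F (X i ω) y

/-- `w(B)`, the number of design points in `B`, with multiplicity. -/
def designCount {n : ℕ} (X : Fin n → ℝ) (B : Set ℝ) : ℕ :=
  {i | X i ∈ B}.ncard

/-- The unconstrained estimator at a design point `x`: the empirical distribution function of the
responses `Y i` with `X i = x`. -/
def naiveCdf {n : ℕ} (X Y : Fin n → ℝ) (x y : ℝ) : ℝ :=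
  (designCount X {x} : ℝ)⁻¹ * ∑ i with X i = x, if Y i ≤ y then (1 : ℝ) else 0

/-- The weighted least squares criterion at `y`, a sum over the distinct design points. -/
def lsCriterion {n : ℕ} (X Y : Fin n → ℝ) (y : ℝ) (f : ℝ → ℝ) : ℝ :=
  ∑ x ∈ Finset.univ.image X, (designCount X {x} : ℝ) * (naiveCdf X Y x y - f x) ^ 2

/-- `Fhat x y` is a monotone least squares estimator computed from the data `(X i, Y i)`: at the
design points it minimizes the least squares criterion among all antitonic functions on the set of
design points; it is extrapolated by constants to the left and to the right of the design points
and is interpolated antitonically (but otherwise arbitrarily) in between. -/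
structure IsMonotoneLSEstimator (𝒳 : Set ℝ) {n : ℕ} (X Y : Fin n → ℝ) (Fhat : ℝ → ℝ → ℝ) :
    Prop where
  minimal : ∀ (y : ℝ) (f : ℝ → ℝ), AntitoneOn f (Set.range X) →
    lsCriterion X Y y (fun x => Fhat x y) ≤ lsCriterion X Y y f
  antitone : ∀ y, AntitoneOn (fun x => Fhat x y) 𝒳
  left : ∀ x ∈ 𝒳, ∀ i, (∀ k, X i ≤ X k) → x ≤ X i → ∀ y, Fhat x y = Fhat (X i) y
  right : ∀ x ∈ 𝒳, ∀ i, (∀ k, X k ≤ X i) → X i ≤ x → ∀ y, Fhat x y = Fhat (X i) y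

/-- `ρ n = log n / n`. -/
def rho (n : ℕ) : ℝ := Real.log n / n

/-- `δ n = C₃ (ρ n) ^ (1 / (2 α + 1))`. -/
def delta (C₃ α : ℝ) (n : ℕ) : ℝ := C₃ * rho n ^ (1 / (2 * α + 1))

/-- Uniform Hölder continuity of `x ↦ F x y` on `I`, for `y ∈ J`. -/
def HolderInCovariate (F : ℝ → ℝ → ℝ) (I J : Set ℝ) (α C₁ : ℝ) : Prop :=
  ∀ w ∈ I, ∀ x ∈ I, ∀ y ∈ J, |F w y - F x y| ≤ C₁ * |w - x| ^ α

/-- The design is dense: every interval `S ⊆ I` of length at least `δ` satisfies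
`w(S) / (n λ(S)) ≥ C₂` (the quotient being `0` if `S` has infinite length). -/
def DenseDesign {n : ℕ} (X : Fin n → ℝ) (I : Set ℝ) (C₂ δ : ℝ) : Prop :=
  ∀ S : Set ℝ, S.OrdConnected → S ⊆ I → ENNReal.ofReal δ ≤ volume S →
    ENNReal.ofReal C₂ ≤ (designCount X S : ℝ≥0∞) / ((n : ℝ≥0∞) * volume S)

/-- `{x : [x - δ, x + δ] ⊆ I}`. -/
def shrunkInterval (I : Set ℝ) (δ : ℝ) : Set ℝ :=
  {x | Set.Icc (x - δ) (x + δ) ⊆ I}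

end MonotoneLS

end

namespace MonotoneLS

theorem measure_le_of_forall_Iic_le {ν : Measure ℝ} [IsFiniteMeasure ν] {U : Set ℝ}
    (hU : MeasurableSet U) {c : ℝ≥0∞} (h : ∀ z ∈ U, ν (Set.Iic z) ≤ c) : ν U ≤ c := by
  rw [hU.measure_eq_iSup_isCompact_of_ne_top (measure_ne_top _ _)]
  simp only [iSup_le_iff]
  intro K hKU hK
  rcases K.eq_empty_or_nonempty with rfl | hne
  · simp
  · obtain ⟨z, hz, hmax⟩ := hK.exists_isGreatest hne
    exact (measure_mono fun x hx => hmax hx).trans (h z (hKU hz))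

theorem measure_le_of_forall_Ici_le {ν : Measure ℝ} [IsFiniteMeasure ν] {V : Set ℝ}
    (hV : MeasurableSet V) {c : ℝ≥0∞} (h : ∀ z ∈ V, ν (Set.Ici z) ≤ c) : ν V ≤ c := by
  rw [hV.measure_eq_iSup_isCompact_of_ne_top (measure_ne_top _ _)]
  simp only [iSup_le_iff]
  intro K hKV hK
  rcases K.eq_empty_or_nonempty with rfl | hne
  · simp
  · obtain ⟨z, hz, hmin⟩ := hK.exists_isLeast hne
    exact (measure_mono fun x hx => hmin hx).trans (h z (hKV hz))

/-- Bracketing of half-lines: for a measure of total mass `w` there are `w + 1` brackets, each of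
mass at most one. -/
theorem exists_brackets (ν : Measure ℝ) [IsFiniteMeasure ν] (w : ℕ) (hw : ν.real Set.univ = w) :
    ∃ B U : ℕ → Set ℝ, (∀ m, MeasurableSet (B m)) ∧ (∀ m, MeasurableSet (U m)) ∧
      ∀ t : ℝ, ∃ m ≤ w, B m ⊆ Set.Iic t ∧ Set.Iic t ⊆ U m ∧
        ν.real (U m) ≤ ν.real (Set.Iic t) + 1 ∧ ν.real (Set.Iic t) ≤ ν.real (B m) + 1 := by
  have hmono : Monotone fun t => ν.real (Set.Iic t) := fun s t h =>
    measureReal_mono (Set.Iic_subset_Iic.2 h)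
  have hB : ∀ m : ℕ, MeasurableSet {z | ∀ t, (m : ℝ) ≤ ν.real (Set.Iic t) → z ≤ t} := fun m =>
    Set.OrdConnected.measurableSet
      ⟨fun x _ y hy z hz t ht => hz.2.trans (hy t ht)⟩
  have hU : ∀ m : ℕ, MeasurableSet {z | ν.real (Set.Iic z) < m + 1} := fun m =>
    Set.OrdConnected.measurableSet
      ⟨fun x _ y hy z hz => lt_of_le_of_lt (hmono hz.2) hy⟩
  refine ⟨_, _, hB, hU, fun t => ?_⟩
  have h0 : 0 ≤ ν.real (Set.Iic t) := measureReal_nonneg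
  have hfl := Nat.floor_le h0
  have hlt := Nat.lt_floor_add_one (ν.real (Set.Iic t))
  have hle : ⌊ν.real (Set.Iic t)⌋₊ ≤ w := by
    apply Nat.floor_le_of_le
    rw [← hw]
    exact measureReal_mono (Set.subset_univ _)
  refine ⟨⌊ν.real (Set.Iic t)⌋₊, hle, fun z hz => hz t hfl,
    fun z hz => lt_of_le_of_lt (hmono hz) hlt, ?_, ?_⟩
  · have : ν.real {z | ν.real (Set.Iic z) < (⌊ν.real (Set.Iic t)⌋₊ : ℝ) + 1} ≤
        (⌊ν.real (Set.Iic t)⌋₊ : ℝ) + 1 := by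
      refine ENNReal.toReal_le_of_le_ofReal (by positivity) ?_
      refine measure_le_of_forall_Iic_le (hU _) fun z hz => ?_
      rw [← ofReal_measureReal]
      exact ENNReal.ofReal_le_ofReal (le_of_lt hz)
    linarith
  · set m := ⌊ν.real (Set.Iic t)⌋₊
    have : ν.real {z | ∀ t, (m : ℝ) ≤ ν.real (Set.Iic t) → z ≤ t}ᶜ ≤ w - m := by
      have hmw : (m : ℝ) ≤ w := by exact_mod_cast hle
      refine ENNReal.toReal_le_of_le_ofReal (by linarith) ?_
      refine measure_le_of_forall_Ici_le (hB _).compl fun z hz => ?_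
      simp only [Set.mem_compl_iff, Set.mem_ofPred_eq, not_forall, not_le] at hz
      obtain ⟨s, hs, hsz⟩ := hz
      rw [← ofReal_measureReal]
      refine ENNReal.ofReal_le_ofReal ?_
      calc ν.real (Set.Ici z) ≤ ν.real (Set.Iic s)ᶜ :=
            measureReal_mono fun u hu => not_le.2 (lt_of_lt_of_le hsz hu)
        _ = w - ν.real (Set.Iic s) := by rw [measureReal_compl measurableSet_Iic, hw]
        _ ≤ w - m := by linarith
    rw [measureReal_compl (hB _), hw] at this
    linarith

variable {n : ℕ}

/-- The centred number of `k ∈ A` with `y k ∈ S`. -/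
noncomputable def deviation (ν : Fin n → Measure ℝ) (A : Finset (Fin n)) (S : Set ℝ)
    (y : Fin n → ℝ) : ℝ :=
  ∑ k ∈ A, (S.indicator (fun _ => (1 : ℝ)) (y k) - (ν k).real S)

theorem hoeffding_deviation (ν : Fin n → Measure ℝ) [∀ k, IsProbabilityMeasure (ν k)]
    (A : Finset (Fin n)) {S : Set ℝ} (hS : MeasurableSet S) {η : ℝ} (hη : 0 ≤ η) :
    (Measure.pi ν).real {y | η ≤ |deviation ν A S y|} ≤
      2 * Real.exp (-(2 * η ^ 2 / A.card)) := by
  have hmeas : Measurable (S.indicator fun _ : ℝ => (1 : ℝ)) := measurable_const.indicator hS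
  have hint : ∀ k, ∫ y, S.indicator (fun _ => (1 : ℝ)) (y k) ∂(Measure.pi ν) = (ν k).real S := by
    intro k
    have h := integral_map (μ := Measure.pi ν) (φ := Function.eval k)
      (measurable_pi_apply k).aemeasurable hmeas.aestronglyMeasurable
    rw [(measurePreserving_eval ν k).map_eq] at h
    exact h.symm.trans (integral_indicator_one hS)
  have hsub : ∀ k, HasSubgaussianMGF
      (fun y : Fin n → ℝ => S.indicator (fun _ => (1 : ℝ)) (y k) - (ν k).real S)
      ((‖(1 : ℝ) - 0‖₊ / 2) ^ 2) (Measure.pi ν) := by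
    intro k
    have := hasSubgaussianMGF_of_mem_Icc (μ := Measure.pi ν) (a := 0) (b := 1)
      (X := fun y : Fin n → ℝ => S.indicator (fun _ => (1 : ℝ)) (y k))
      (hmeas.comp (measurable_pi_apply k)).aemeasurable
      (ae_of_all _ fun y => ⟨Set.indicator_nonneg (fun _ _ => zero_le_one) _,
        Set.indicator_le_self' (fun _ _ => zero_le_one) _⟩)
    rwa [hint k] at this
  have hind : iIndepFun (fun k (y : Fin n → ℝ) =>
      S.indicator (fun _ => (1 : ℝ)) (y k) - (ν k).real S) (Measure.pi ν) :=
    iIndepFun_pi (X := fun k (z : ℝ) => S.indicator (fun _ => (1 : ℝ)) z - (ν k).real S)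
      fun k => (hmeas.sub_const _).aemeasurable
  have hsum : (2 * ((∑ i ∈ A, (‖(1 : ℝ) - 0‖₊ / 2) ^ 2 : NNReal) : ℝ)) = A.card / 2 := by
    simp; ring
  have hexp : Real.exp (-η ^ 2 / (A.card / 2)) = Real.exp (-(2 * η ^ 2 / A.card)) := by
    congr 1
    rw [div_div_eq_mul_div]; ring
  have h1 := HasSubgaussianMGF.measure_sum_ge_le_of_iIndepFun hind (s := A)
    (fun k _ => hsub k) hη
  have h2 := HasSubgaussianMGF.measure_sum_ge_le_of_iIndepFun
    (hind.comp (fun _ => Neg.neg) fun _ => measurable_neg) (s := A)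
    (fun k _ => (hsub k).neg) hη
  rw [hsum, hexp] at h1 h2
  calc (Measure.pi ν).real {y | η ≤ |deviation ν A S y|}
      ≤ (Measure.pi ν).real ({y | η ≤ ∑ k ∈ A, (S.indicator (fun _ => (1 : ℝ)) (y k) -
          (ν k).real S)} ∪ {y | η ≤ ∑ k ∈ A, (Neg.neg ∘ fun y : Fin n → ℝ =>
            (S.indicator (fun _ => (1 : ℝ)) (y k) - (ν k).real S)) y}) := by
        refine measureReal_mono fun y hy => ?_
        simp only [Set.mem_ofPred_eq, deviation, Set.mem_union, Function.comp,
          Finset.sum_neg_distrib] at hy ⊢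
        exact le_abs.1 hy
    _ ≤ _ := measureReal_union_le _ _
    _ ≤ _ := by linarith

theorem uniform_deviation (ν : Fin n → Measure ℝ) [∀ k, IsProbabilityMeasure (ν k)]
    (A : Finset (Fin n)) {η : ℝ} (hη : 0 ≤ η) :
    (Measure.pi ν).real {y | ∃ t, η + 1 < |deviation ν A (Set.Iic t) y|} ≤
      4 * (A.card + 1) * Real.exp (-(2 * η ^ 2 / A.card)) := by
  have happ : ∀ S, (∑ k ∈ A, ν k).real S = ∑ k ∈ A, (ν k).real S := by
    intro S
    simp only [measureReal_def, Measure.finsetSum_apply]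
    exact ENNReal.toReal_sum fun _ _ => measure_ne_top _ _
  obtain ⟨B, U, hB, hU, hbr⟩ := exists_brackets (∑ k ∈ A, ν k) A.card (by simp [happ])
  have hdev : ∀ S y, deviation ν A S y =
      ∑ k ∈ A, S.indicator (fun _ => (1 : ℝ)) (y k) - (∑ k ∈ A, ν k).real S := by
    intro S y
    rw [deviation, Finset.sum_sub_distrib, happ]
  have hcount : ∀ {S T : Set ℝ} (y : Fin n → ℝ), S ⊆ T →
      ∑ k ∈ A, S.indicator (fun _ => (1 : ℝ)) (y k) ≤
        ∑ k ∈ A, T.indicator (fun _ => (1 : ℝ)) (y k) := fun y h =>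
    Finset.sum_le_sum fun k _ => Set.indicator_le_indicator_of_subset h (fun _ => zero_le_one) _
  calc (Measure.pi ν).real {y | ∃ t, η + 1 < |deviation ν A (Set.Iic t) y|}
      ≤ (Measure.pi ν).real (⋃ m ∈ Finset.range (A.card + 1),
          ({y | η ≤ |deviation ν A (B m) y|} ∪ {y | η ≤ |deviation ν A (U m) y|})) := by
        refine measureReal_mono (fun y ⟨t, ht⟩ => ?_) (measure_ne_top _ _)
        obtain ⟨m, hm, hBt, htU, hUt, htB⟩ := hbr t
        simp only [Set.mem_iUnion, Finset.mem_range, Set.mem_union, Set.mem_ofPred_eq]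
        refine ⟨m, by omega, ?_⟩
        by_contra! hcon
        rw [hdev] at ht hcon
        rw [hdev] at hcon
        have h1 := hcount y hBt
        have h2 := hcount y htU
        have h3 := abs_lt.1 hcon.1
        have h4 := abs_lt.1 hcon.2
        refine absurd ht (not_lt.2 (abs_le.2 ⟨?_, ?_⟩)) <;> linarith
    _ ≤ ∑ m ∈ Finset.range (A.card + 1), (Measure.pi ν).real
          ({y | η ≤ |deviation ν A (B m) y|} ∪ {y | η ≤ |deviation ν A (U m) y|}) :=
        measureReal_biUnion_finset_le _ _
    _ ≤ ∑ m ∈ Finset.range (A.card + 1), 4 * Real.exp (-(2 * η ^ 2 / A.card)) := by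
        refine Finset.sum_le_sum fun m _ => (measureReal_union_le _ _).trans ?_
        linarith [hoeffding_deviation ν A (hB m) hη, hoeffding_deviation ν A (hU m) hη]
    _ = _ := by
        rw [Finset.sum_const, Finset.card_range, nsmul_eq_mul]
        push_cast
        ring

/-- The Stieltjes function of a distribution function. -/
def IsDistributionFunction.stieltjes {G : ℝ → ℝ} (h : IsDistributionFunction G) :
    StieltjesFunction ℝ := ⟨G, h.mono, h.right_cts⟩

theorem IsDistributionFunction.measure_Iic {G : ℝ → ℝ} (h : IsDistributionFunction G) (t : ℝ) :
    h.stieltjes.measure (Set.Iic t) = ENNReal.ofReal (G t) := by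
  have := h.stieltjes.measure_Iic (l := 0) h.tendsto_atBot t
  rw [this, sub_zero]
  rfl

theorem IsDistributionFunction.nonneg {G : ℝ → ℝ} (h : IsDistributionFunction G) (t : ℝ) :
    0 ≤ G t := h.mono.le_of_tendsto h.tendsto_atBot t

open Classical in
/-- The response distribution at the covariate value `x`, a point mass if `x ∉ 𝒳`. -/
noncomputable def responseLaw {𝒳 : Set ℝ} {F : ℝ → ℝ → ℝ} (hF : IsStochIsotonicFamily 𝒳 F) (x : ℝ) :
    Measure ℝ :=
  if h : x ∈ 𝒳 then (hF.isDistributionFunction x h).stieltjes.measure else Measure.dirac 0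

section

variable {𝒳 : Set ℝ} {F : ℝ → ℝ → ℝ} (hF : IsStochIsotonicFamily 𝒳 F)

theorem responseLaw_Iic {x : ℝ} (hx : x ∈ 𝒳) (t : ℝ) :
    responseLaw hF x (Set.Iic t) = ENNReal.ofReal (F x t) := by
  rw [responseLaw, dif_pos hx, IsDistributionFunction.measure_Iic]

theorem responseLaw_real_Iic {x : ℝ} (hx : x ∈ 𝒳) (t : ℝ) :
    (responseLaw hF x).real (Set.Iic t) = F x t := by
  rw [measureReal_def, responseLaw_Iic hF hx,
    ENNReal.toReal_ofReal ((hF.isDistributionFunction x hx).nonneg t)]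

instance isProbabilityMeasure_responseLaw (x : ℝ) : IsProbabilityMeasure (responseLaw hF x) := by
  unfold responseLaw
  split_ifs with h
  · exact StieltjesFunction.isProbabilityMeasure _ (hF.isDistributionFunction x h).tendsto_atBot
      (hF.isDistributionFunction x h).tendsto_atTop
  · infer_instance

theorem measurable_responseLaw (h𝒳 : 𝒳.OrdConnected) : Measurable (responseLaw hF) := by
  refine Measurable.measure_of_isPiSystem_of_isProbabilityMeasure (borel_eq_generateFrom_Iic ℝ)
    isPiSystem_Iic ?_
  rintro _ ⟨t, rfl⟩
  refine measurable_of_restrict_of_restrict_compl h𝒳.measurableSet ?_ ?_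
  · refine Antitone.measurable fun x y hxy => ?_
    simp only [Set.domRestrict_apply, responseLaw_Iic hF x.2, responseLaw_Iic hF y.2]
    exact ENNReal.ofReal_le_ofReal (hF.antitone t x.2 y.2 hxy)
  · have : (𝒳ᶜ).domRestrict (fun x => responseLaw hF x (Set.Iic t)) =
        fun _ => Measure.dirac (0 : ℝ) (Set.Iic t) := by
      ext x
      rw [Set.domRestrict_apply, responseLaw, dif_neg x.2]
    rw [this]
    exact measurable_const

theorem generateFrom_pi_Iic (n : ℕ) :
    MeasurableSpace.generateFrom (Set.pi Set.univ '' Set.pi Set.univ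
      fun _ : Fin n => Set.range (Set.Iic : ℝ → Set ℝ)) = MeasurableSpace.pi := by
  refine generateFrom_eq_pi (fun _ => (borel_eq_generateFrom_Iic ℝ).symm.trans
    (BorelSpace.measurable_eq).symm) fun _ => ⟨fun k : ℕ => Set.Iic (k : ℝ), fun k => ⟨k, rfl⟩, ?_⟩
  ext x
  simpa using exists_nat_ge x

/-- Given covariates `x`, the responses are independent with laws `responseLaw hF (x i)`. -/
noncomputable def responseKernel (h𝒳 : 𝒳.OrdConnected) (n : ℕ) :
    Kernel (Fin n → ℝ) (Fin n → ℝ) where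
  toFun x := Measure.pi fun i => responseLaw hF (x i)
  measurable' := by
    refine Measurable.measure_of_isPiSystem_of_isProbabilityMeasure
      (generateFrom_pi_Iic n).symm (IsPiSystem.pi fun _ => isPiSystem_Iic) ?_
    rintro _ ⟨B, hB, rfl⟩
    simp only [Measure.pi_pi]
    refine Finset.measurable_prod _ fun i _ => ?_
    obtain ⟨t, ht⟩ := hB i (Set.mem_univ i)
    exact ((Measure.measurable_coe (ht ▸ measurableSet_Iic)).comp
      (measurable_responseLaw hF h𝒳)).comp (measurable_pi_apply i)

theorem responseKernel_apply (h𝒳 : 𝒳.OrdConnected) {n : ℕ} (x : Fin n → ℝ) :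
    responseKernel hF h𝒳 n x = Measure.pi fun i => responseLaw hF (x i) := rfl

instance (h𝒳 : 𝒳.OrdConnected) (n : ℕ) : IsMarkovKernel (responseKernel hF h𝒳 n) :=
  ⟨fun x => by rw [responseKernel_apply]; infer_instance⟩

variable {Ω : Type*} [MeasurableSpace Ω] {P : Measure Ω} [IsProbabilityMeasure P] {n : ℕ}
  {X Y : Fin n → Ω → ℝ}

theorem IsSample.measure_rectangle (hF : IsStochIsotonicFamily 𝒳 F) (hS : IsSample P 𝒳 F X Y)
    {A : Set (Fin n → ℝ)} (hA : MeasurableSet A) (b : Fin n → ℝ) :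
    P ((fun ω i => X i ω) ⁻¹' A ∩ ⋂ i, Y i ⁻¹' Set.Iic (b i)) =
      ∫⁻ ω in (fun ω i => X i ω) ⁻¹' A, ∏ i, ENNReal.ofReal (F (X i ω) (b i)) ∂P := by
  have hX : Measurable fun ω i => X i ω := measurable_pi_lambda _ hS.measurable_X
  have hm : covariateSigma X ≤ ‹MeasurableSpace Ω› := hX.comap_le
  have hT : MeasurableSet (⋂ i, Y i ⁻¹' Set.Iic (b i)) :=
    MeasurableSet.iInter fun i => hS.measurable_Y i measurableSet_Iic
  have hae : P⟦⋂ i, Y i ⁻¹' Set.Iic (b i) | covariateSigma X⟧ =ᵐ[P]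
      fun ω => ∏ i, F (X i ω) (b i) := by
    have h := ae_all_iff.2 fun i => hS.condCdf i (b i)
    filter_upwards [hS.condIndep (fun i => Set.Iic (b i)) fun _ => measurableSet_Iic, h]
      with ω h1 h2
    rw [h1]
    exact Finset.prod_congr rfl fun i _ => h2 i
  have hint : Integrable (fun ω => ∏ i, F (X i ω) (b i)) P := integrable_condExp.congr hae
  have hnn : ∀ i ω, 0 ≤ F (X i ω) (b i) := fun i ω =>
    (hF.isDistributionFunction _ (hS.mem i ω)).nonneg _
  have key := setIntegral_condExp hm
    (f := (⋂ i, Y i ⁻¹' Set.Iic (b i)).indicator fun _ => (1 : ℝ))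
    ((integrable_const (μ := P) (1 : ℝ)).indicator hT) (s := (fun ω i => X i ω) ⁻¹' A) ⟨A, hA, rfl⟩
  rw [setIntegral_congr_ae (hX hA) (hae.mono fun ω h _ => h)] at key
  have hr : ∫ ω in (fun ω i => X i ω) ⁻¹' A,
      (⋂ i, Y i ⁻¹' Set.Iic (b i)).indicator (fun _ => (1 : ℝ)) ω ∂P =
        P.real ((fun ω i => X i ω) ⁻¹' A ∩ ⋂ i, Y i ⁻¹' Set.Iic (b i)) := by
    rw [setIntegral_indicator hT, setIntegral_const]
    simp
  rw [hr] at key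
  rw [← ofReal_measureReal, ← key, ofReal_integral_eq_lintegral_ofReal hint.integrableOn
    (ae_of_all _ fun ω => Finset.prod_nonneg fun i _ => hnn i ω)]
  exact lintegral_congr fun ω => ENNReal.ofReal_prod_of_nonneg fun i _ => hnn i ω

theorem IsSample.map_eq_compProd (h𝒳 : 𝒳.OrdConnected) (hS : IsSample P 𝒳 F X Y) :
    P.map (fun ω => ((fun i => X i ω), fun i => Y i ω)) =
      (P.map fun ω i => X i ω) ⊗ₘ responseKernel hF h𝒳 n := by
  have hX : Measurable fun ω i => X i ω := measurable_pi_lambda _ hS.measurable_X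
  have hY : Measurable fun ω i => Y i ω := measurable_pi_lambda _ hS.measurable_Y
  have := Measure.isProbabilityMeasure_map (μ := P) hX.aemeasurable
  have := Measure.isProbabilityMeasure_map (μ := P) (hX.prodMk hY).aemeasurable
  refine ext_of_generate_finite _ ((generateFrom_eq_prod MeasurableSpace.generateFrom_measurableSet
    (generateFrom_pi_Iic n) isCountablySpanning_measurableSet ?_).symm)
    (MeasurableSpace.isPiSystem_measurableSet.prod (IsPiSystem.pi fun _ => isPiSystem_Iic)) ?_ (by simp)
  · refine IsCountablySpanning.pi fun _ => ⟨fun k : ℕ => Set.Iic (k : ℝ), fun k => ⟨k, rfl⟩, ?_⟩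
    ext x
    simpa using exists_nat_ge x
  · rintro _ ⟨A, hA, _, ⟨B, hB, rfl⟩, rfl⟩
    choose b hb using fun i => hB i (Set.mem_univ i)
    obtain rfl : (fun i => Set.Iic (b i)) = B := funext hb
    have hA : MeasurableSet A := hA
    have hBm : MeasurableSet (Set.univ.pi fun i => Set.Iic (b i)) :=
      MeasurableSet.univ_pi fun _ => measurableSet_Iic
    rw [Measure.map_apply (hX.prodMk hY) (hA.prod hBm), Measure.compProd_apply_prod hA hBm,
      setLIntegral_map hA (Kernel.measurable_coe _ hBm) hX]
    have hset : (fun ω => ((fun i => X i ω), fun i => Y i ω)) ⁻¹'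
        (A ×ˢ Set.univ.pi fun i => Set.Iic (b i)) =
          (fun ω i => X i ω) ⁻¹' A ∩ ⋂ i, Y i ⁻¹' Set.Iic (b i) := by
      ext ω; simp [Pi.le_def]
    rw [hset, hS.measure_rectangle hF hA]
    refine lintegral_congr fun ω => ?_
    rw [responseKernel_apply, Measure.pi_pi]
    exact Finset.prod_congr rfl fun i _ => (responseLaw_Iic hF (hS.mem i ω) _).symm

theorem IsSample.measure_le_of_forall (h𝒳 : 𝒳.OrdConnected) (hS : IsSample P 𝒳 F X Y)
    {E : Set ((Fin n → ℝ) × (Fin n → ℝ))} (hE : MeasurableSet E) {c : ℝ≥0∞}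
    (hc : ∀ x, Measure.pi (fun i => responseLaw hF (x i)) {y | (x, y) ∈ E} ≤ c) :
    P {ω | ((fun i => X i ω), fun i => Y i ω) ∈ E} ≤ c := by
  have hX : Measurable fun ω i => X i ω := measurable_pi_lambda _ hS.measurable_X
  have hY : Measurable fun ω i => Y i ω := measurable_pi_lambda _ hS.measurable_Y
  have := Measure.isProbabilityMeasure_map (μ := P) hX.aemeasurable
  calc P {ω | ((fun i => X i ω), fun i => Y i ω) ∈ E}
      = P.map (fun ω => ((fun i => X i ω), fun i => Y i ω)) E :=
        (Measure.map_apply (hX.prodMk hY) hE).symm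
    _ = ∫⁻ x, responseKernel hF h𝒳 n x (Prod.mk x ⁻¹' E) ∂(P.map fun ω i => X i ω) := by
        rw [hS.map_eq_compProd hF h𝒳, Measure.compProd_apply hE]
    _ ≤ ∫⁻ _, c ∂(P.map fun ω i => X i ω) := lintegral_mono fun x => hc x
    _ = c := by simp

end

/-- The indices of the covariates between the `i`-th and the `j`-th one. -/
noncomputable def window {n : ℕ} (x : Fin n → ℝ) (i j : Fin n) : Finset (Fin n) :=
  {k | x i ≤ x k ∧ x k ≤ x j}

/-- All centred empirical distribution functions over windows of covariates are small. -/
def UniformlyClose {n : ℕ} (ν : Fin n → Measure ℝ) (x y : Fin n → ℝ) : Prop :=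
  ∀ i j t, |deviation ν (window x i j) (Set.Iic t) y| ≤
    2 * √(Real.log n * (window x i j).card) + 1

theorem continuousWithinAt_deviation {n : ℕ} (ν : Fin n → Measure ℝ)
    [∀ k, IsProbabilityMeasure (ν k)] (A : Finset (Fin n)) (y : Fin n → ℝ) (t : ℝ) :
    ContinuousWithinAt (fun t => deviation ν A (Set.Iic t) y) (Set.Ioi t) t := by
  have h : ∀ (μ : Measure ℝ) [IsProbabilityMeasure μ],
      ContinuousWithinAt (fun t => μ.real (Set.Iic t)) (Set.Ioi t) t := by
    intro μ _
    simp_rw [← cdf_eq_real]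
    exact ((cdf μ).right_continuous t).mono Set.Ioi_subset_Ici_self
  have hd : ∀ (k : Fin n) (s : ℝ), (Set.Iic s).indicator (fun _ => (1 : ℝ)) (y k) =
      (Measure.dirac (y k)).real (Set.Iic s) := by
    intro k s
    rw [measureReal_def, Measure.dirac_apply' _ measurableSet_Iic]
    by_cases hk : y k ≤ s <;> simp [hk]
  unfold deviation
  simp_rw [hd]
  exact tendsto_finsetSum _ fun k _ => (h _).sub (h _)

theorem uniformlyClose_iff_rat {n : ℕ} (ν : Fin n → Measure ℝ) [∀ k, IsProbabilityMeasure (ν k)]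
    (x y : Fin n → ℝ) : UniformlyClose ν x y ↔ ∀ i j, ∀ q : ℚ,
      |deviation ν (window x i j) (Set.Iic (q : ℝ)) y| ≤
        2 * √(Real.log n * (window x i j).card) + 1 := by
  refine ⟨fun h i j q => h i j q, fun h i j t => ?_⟩
  by_contra! hcon
  have hev := (continuousWithinAt_deviation ν (window x i j) y t).abs.eventually_const_lt hcon
  obtain ⟨u, hu, hsub⟩ := mem_nhdsGT_iff_exists_Ioo_subset.1 hev
  obtain ⟨q, hq1, hq2⟩ := exists_rat_btwn (Set.mem_Ioi.1 hu)
  exact absurd (h i j q) (not_le.2 (hsub ⟨hq1, hq2⟩))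

theorem pi_not_uniformlyClose_le {n : ℕ} (hn : 1 ≤ n) (ν : Fin n → Measure ℝ)
    [∀ k, IsProbabilityMeasure (ν k)] (x : Fin n → ℝ) :
    Measure.pi ν {y | ¬ UniformlyClose ν x y} ≤
      ENNReal.ofReal (n * n * (4 * (n + 1) * Real.exp (-(8 * Real.log n)))) := by
  have hlog : 0 ≤ Real.log n := Real.log_natCast_nonneg n
  have hwin : ∀ i j, (Measure.pi ν).real {y | ∃ t, 2 * √(Real.log n * (window x i j).card) + 1 <
      |deviation ν (window x i j) (Set.Iic t) y|} ≤
        4 * (n + 1) * Real.exp (-(8 * Real.log n)) := by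
    intro i j
    rcases (window x i j).eq_empty_or_nonempty with h0 | hne
    · have : {y | ∃ t, 2 * √(Real.log n * (window x i j).card) + 1 <
          |deviation ν (window x i j) (Set.Iic t) y|} = ∅ := by
        ext y
        simp [h0, deviation, not_lt.2 (zero_le_one' ℝ)]
      rw [this]
      simp only [measureReal_empty]
      positivity
    · have hpos : (0 : ℝ) < (window x i j).card := by exact_mod_cast hne.card_pos
      have hcard : ((window x i j).card : ℝ) ≤ n := by
        exact_mod_cast (Finset.card_le_univ _).trans (by simp)
      refine (uniform_deviation ν (window x i j) (by positivity)).trans ?_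
      have : 2 * (2 * √(Real.log n * (window x i j).card)) ^ 2 / (window x i j).card =
          8 * Real.log n := by
        rw [mul_pow, Real.sq_sqrt (by positivity)]
        field_simp
        ring
      rw [this]
      gcongr
  rw [← ofReal_measureReal]
  refine ENNReal.ofReal_le_ofReal ?_
  calc (Measure.pi ν).real {y | ¬ UniformlyClose ν x y}
      ≤ (Measure.pi ν).real (⋃ p ∈ (Finset.univ : Finset (Fin n × Fin n)),
          {y | ∃ t, 2 * √(Real.log n * (window x p.1 p.2).card) + 1 <
            |deviation ν (window x p.1 p.2) (Set.Iic t) y|}) := by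
        refine measureReal_mono (fun y hy => ?_) (measure_ne_top _ _)
        simp only [Set.mem_ofPred_eq, UniformlyClose, not_forall, not_le] at hy
        obtain ⟨i, j, t, h⟩ := hy
        simp only [Set.mem_iUnion, Set.mem_ofPred_eq]
        exact ⟨(i, j), Finset.mem_univ _, t, h⟩
    _ ≤ _ := measureReal_biUnion_finset_le _ _
    _ ≤ ∑ _p : Fin n × Fin n, 4 * ((n : ℝ) + 1) * Real.exp (-(8 * Real.log n)) :=
        Finset.sum_le_sum fun p _ => hwin p.1 p.2
    _ = _ := by simp

section

variable {𝒳 : Set ℝ} {F : ℝ → ℝ → ℝ} (hF : IsStochIsotonicFamily 𝒳 F)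

theorem measurable_window_card {n : ℕ} (i j : Fin n) :
    Measurable fun x : Fin n → ℝ => ((window x i j).card : ℝ) := by
  simp only [window, Finset.card_filter, Nat.cast_sum]
  refine Finset.measurable_sum _ fun k _ => ?_
  refine (measurable_from_top (f := fun m : ℕ => (m : ℝ))).comp (Measurable.ite ?_ measurable_const measurable_const)
  exact (measurableSet_le (measurable_pi_apply i) (measurable_pi_apply k)).inter
    (measurableSet_le (measurable_pi_apply k) (measurable_pi_apply j))

theorem measurable_deviation_window (h𝒳 : 𝒳.OrdConnected) {n : ℕ} (i j : Fin n) (t : ℝ) :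
    Measurable fun p : (Fin n → ℝ) × (Fin n → ℝ) =>
      deviation (fun k => responseLaw hF (p.1 k)) (window p.1 i j) (Set.Iic t) p.2 := by
  simp only [window, deviation, Finset.sum_filter]
  refine Finset.measurable_sum _ fun k _ => Measurable.ite ?_ ?_ measurable_const
  · have h : ∀ l : Fin n, Measurable fun p : (Fin n → ℝ) × (Fin n → ℝ) => p.1 l := fun l =>
      (measurable_pi_apply l).comp measurable_fst
    exact (measurableSet_le (h i) (h k)).inter (measurableSet_le (h k) (h j))
  · refine Measurable.sub ?_ ?_
    · exact (measurable_const.indicator measurableSet_Iic).comp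
        ((measurable_pi_apply k).comp measurable_snd)
    · exact (((Measure.measurable_coe measurableSet_Iic).comp
        (measurable_responseLaw hF h𝒳)).comp
          ((measurable_pi_apply k).comp measurable_fst)).ennreal_toReal

theorem measurableSet_not_uniformlyClose (h𝒳 : 𝒳.OrdConnected) (n : ℕ) :
    MeasurableSet {p : (Fin n → ℝ) × (Fin n → ℝ) |
      ¬ UniformlyClose (fun k => responseLaw hF (p.1 k)) p.1 p.2} := by
  refine MeasurableSet.compl (s := {p : (Fin n → ℝ) × (Fin n → ℝ) |
      UniformlyClose (fun k => responseLaw hF (p.1 k)) p.1 p.2}) ?_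
  simp only [uniformlyClose_iff_rat, Set.ofPred_forall]
  refine .iInter fun i => .iInter fun j => .iInter fun q => measurableSet_le ?_ ?_
  · exact (measurable_deviation_window hF h𝒳 i j q).abs
  · exact ((((measurable_window_card i j).comp measurable_fst).const_mul _).sqrt.const_mul 2).add_const 1

theorem IsSample.measure_not_uniformlyClose_le (h𝒳 : 𝒳.OrdConnected) {Ω : Type*}
    [MeasurableSpace Ω] {P : Measure Ω} [IsProbabilityMeasure P] {n : ℕ} (hn : 1 ≤ n)
    {X Y : Fin n → Ω → ℝ} (hS : IsSample P 𝒳 F X Y) :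
    P {ω | ¬ UniformlyClose (fun k => responseLaw hF (X k ω)) (fun k => X k ω) fun k => Y k ω} ≤
      ENNReal.ofReal (n * n * (4 * (n + 1) * Real.exp (-(8 * Real.log n)))) :=
  hS.measure_le_of_forall hF h𝒳 (measurableSet_not_uniformlyClose hF h𝒳 n) fun x =>
    pi_not_uniformlyClose_le hn _ x

end

theorem deriv_criterion_nonpos {A B : ℝ} {ε₀ : ℝ} (hε₀ : 0 < ε₀)
    (h : ∀ ε, 0 < ε → ε ≤ ε₀ → 0 ≤ -(2 * ε * A) + ε ^ 2 * B) : A ≤ 0 := by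
  by_contra! hA
  have hB := abs_nonneg B
  set ε := min ε₀ (A / (|B| + 1)) with hε
  have hpos : 0 < ε := lt_min hε₀ (by positivity)
  have h1 := h ε hpos (min_le_left _ _)
  have h2 : ε * (|B| + 1) ≤ A := by
    rw [← le_div_iff₀ (by positivity)]
    exact min_le_right _ _
  have h3 := le_abs_self B
  nlinarith

/-- First order condition at a minimizer of the least squares criterion. -/
theorem first_order_condition {n : ℕ} {X Y : Fin n → ℝ} {y : ℝ} {f : ℝ → ℝ}
    (hmin : ∀ g, AntitoneOn g (Set.range X) → lsCriterion X Y y f ≤ lsCriterion X Y y g)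
    (h : ℝ → ℝ) {ε₀ : ℝ} (hε₀ : 0 < ε₀)
    (hanti : ∀ ε, 0 < ε → ε ≤ ε₀ → AntitoneOn (fun x => f x + ε * h x) (Set.range X)) :
    ∑ x ∈ Finset.univ.image X, (designCount X {x} : ℝ) * (naiveCdf X Y x y - f x) * h x ≤ 0 := by
  refine deriv_criterion_nonpos (B := ∑ x ∈ Finset.univ.image X,
    (designCount X {x} : ℝ) * h x ^ 2) hε₀ fun ε h0 h1 => ?_
  have := hmin _ (hanti ε h0 h1)
  rw [← sub_nonneg] at this
  refine this.trans_eq ?_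
  simp only [lsCriterion]
  rw [← Finset.sum_sub_distrib, Finset.mul_sum, Finset.mul_sum, ← Finset.sum_neg_distrib,
    ← Finset.sum_add_distrib]
  exact Finset.sum_congr rfl fun x _ => by ring

theorem designCount_singleton {n : ℕ} (X : Fin n → ℝ) (x : ℝ) :
    designCount X {x} = (Finset.univ.filter fun i => X i = x).card := by
  rw [designCount, ← Set.ncard_coe_finset]
  congr 1
  ext i
  simp

theorem sum_image_eq_sum_indices {n : ℕ} (X Y : Fin n → ℝ) (y : ℝ) (f h : ℝ → ℝ) :
    ∑ x ∈ Finset.univ.image X, (designCount X {x} : ℝ) * (naiveCdf X Y x y - f x) * h x =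
      ∑ i, ((if Y i ≤ y then 1 else 0) - f (X i)) * h (X i) := by
  rw [← Finset.sum_fiberwise_of_maps_to (s := Finset.univ) (t := Finset.univ.image X) (g := X)
    fun i hi => Finset.mem_image_of_mem X hi]
  refine Finset.sum_congr rfl fun x hx => ?_
  obtain ⟨i, -, hi⟩ := Finset.mem_image.1 hx
  have hne : (designCount X {x} : ℝ) ≠ 0 := by
    rw [designCount_singleton]
    exact_mod_cast (Finset.card_pos.2 ⟨i, by simpa using hi⟩).ne'
  have h1 : ∑ i with X i = x, ((if Y i ≤ y then 1 else 0) - f (X i)) * h (X i) =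
      ∑ i with X i = x, ((if Y i ≤ y then (1 : ℝ) else 0) - f x) * h x :=
    Finset.sum_congr rfl fun i hi => by rw [(Finset.mem_filter.1 hi).2]
  rw [h1, ← Finset.sum_mul, Finset.sum_sub_distrib, Finset.sum_const, ← designCount_singleton,
    nsmul_eq_mul, naiveCdf, mul_sub, mul_inv_cancel_left₀ hne]

theorem exists_gap {n : ℕ} (X : Fin n → ℝ) (f : ℝ → ℝ) (v : ℝ) :
    ∃ ε₀ : ℝ, 0 < ε₀ ∧ ∀ i, f (X i) ≠ v → ε₀ ≤ |f (X i) - v| := by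
  have h : ∀ i, ∃ e : ℝ, 0 < e ∧ (f (X i) ≠ v → e ≤ |f (X i) - v|) := by
    intro i
    by_cases hi : f (X i) = v
    · exact ⟨1, one_pos, fun h => absurd hi h⟩
    · exact ⟨|f (X i) - v|, abs_pos.2 (sub_ne_zero.2 hi), fun _ => le_rfl⟩
  choose e he1 he2 using h
  rcases isEmpty_or_nonempty (Fin n) with h0 | h0
  · exact ⟨1, one_pos, fun i => h0.elim i⟩
  · obtain ⟨i, hi⟩ := Finite.exists_min e
    exact ⟨e i, he1 i, fun k hk => (hi k).trans (he2 k hk)⟩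

theorem sum_mul_ite_window {n : ℕ} (X : Fin n → ℝ) (i j : Fin n) (g : Fin n → ℝ) :
    ∑ k, g k * (if X i ≤ X k ∧ X k ≤ X j then 1 else 0) = ∑ k ∈ window X i j, g k := by
  simp [window, Finset.sum_filter]

/-- The value of the estimator at a design point `X j` is at most a window average over a window
that starts at a given design point `X i` and extends at least to `X j`. -/
theorem exists_window_right {n : ℕ} {X Y : Fin n → ℝ} {y : ℝ} {f : ℝ → ℝ}
    (hf : AntitoneOn f (Set.range X))
    (hmin : ∀ g, AntitoneOn g (Set.range X) → lsCriterion X Y y f ≤ lsCriterion X Y y g)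
    (i j : Fin n) :
    ∃ s, X j ≤ X s ∧
      (window X i s).card * f (X j) ≤ ∑ k ∈ window X i s, (if Y k ≤ y then (1 : ℝ) else 0) := by
  obtain ⟨s, hs, hmax⟩ := Finset.exists_max_image (Finset.univ.filter fun k => f (X k) = f (X j)) X
    ⟨j, by simp⟩
  simp only [Finset.mem_filter, Finset.mem_univ, true_and] at hs hmax
  have hjs := hmax j rfl
  obtain ⟨ε₀, hε₀, hgap⟩ := exists_gap X f (f (X j))
  have hfo := first_order_condition hmin
    (fun x => -(if X i ≤ x ∧ x ≤ X s then (1 : ℝ) else 0)) hε₀ ?_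
  · rw [sum_image_eq_sum_indices] at hfo
    simp only [mul_neg, Finset.sum_neg_distrib] at hfo
    rw [sum_mul_ite_window X i s fun k => (if Y k ≤ y then (1 : ℝ) else 0) - f (X k),
      Finset.sum_sub_distrib] at hfo
    refine ⟨s, hjs, ?_⟩
    have : ((window X i s).card : ℝ) * f (X j) ≤ ∑ k ∈ window X i s, f (X k) := by
      rw [← nsmul_eq_mul]
      refine Finset.card_nsmul_le_sum _ _ _ fun k hk => ?_
      rw [← hs]
      exact hf ⟨k, rfl⟩ ⟨s, rfl⟩ (Finset.mem_filter.1 hk).2.2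
    linarith
  · rintro ε h0 h1 _ ⟨k, rfl⟩ _ ⟨l, rfl⟩ hkl
    have hkl' := hf ⟨k, rfl⟩ ⟨l, rfl⟩ hkl
    dsimp only
    by_cases hk : X i ≤ X k ∧ X k ≤ X s
    · by_cases hl : X l ≤ X s
      · rw [if_pos hk, if_pos ⟨hk.1.trans hkl, hl⟩]
        linarith
      · rw [if_pos hk, if_neg fun h => hl h.2]
        have hne : f (X l) ≠ f (X j) := fun h => hl (hmax l h)
        have hle : f (X l) ≤ f (X j) := hs ▸ hf ⟨s, rfl⟩ ⟨l, rfl⟩ (not_le.1 hl).le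
        have hks : f (X j) ≤ f (X k) := hs ▸ hf ⟨k, rfl⟩ ⟨s, rfl⟩ hk.2
        have := hgap l hne
        rw [abs_of_nonpos (by linarith)] at this
        linarith
    · rw [if_neg hk]
      split_ifs <;> linarith

/-- The value of the estimator at a design point `X j` is at least a window average over a window
that ends at a given design point `X i` and starts no later than `X j`. -/
theorem exists_window_left {n : ℕ} {X Y : Fin n → ℝ} {y : ℝ} {f : ℝ → ℝ}
    (hf : AntitoneOn f (Set.range X))
    (hmin : ∀ g, AntitoneOn g (Set.range X) → lsCriterion X Y y f ≤ lsCriterion X Y y g)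
    (i j : Fin n) :
    ∃ s, X s ≤ X j ∧
      ∑ k ∈ window X s i, (if Y k ≤ y then (1 : ℝ) else 0) ≤ (window X s i).card * f (X j) := by
  obtain ⟨s, hs, hmin'⟩ := Finset.exists_min_image
    (Finset.univ.filter fun k => f (X k) = f (X j)) X ⟨j, by simp⟩
  simp only [Finset.mem_filter, Finset.mem_univ, true_and] at hs hmin'
  have hjs := hmin' j rfl
  obtain ⟨ε₀, hε₀, hgap⟩ := exists_gap X f (f (X j))
  have hfo := first_order_condition hmin
    (fun x => if X s ≤ x ∧ x ≤ X i then (1 : ℝ) else 0) hε₀ ?_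
  · rw [sum_image_eq_sum_indices] at hfo
    rw [sum_mul_ite_window X s i fun k => (if Y k ≤ y then (1 : ℝ) else 0) - f (X k),
      Finset.sum_sub_distrib] at hfo
    refine ⟨s, hjs, ?_⟩
    have : ∑ k ∈ window X s i, f (X k) ≤ ((window X s i).card : ℝ) * f (X j) := by
      rw [← nsmul_eq_mul]
      refine Finset.sum_le_card_nsmul _ _ _ fun k hk => ?_
      rw [← hs]
      exact hf ⟨s, rfl⟩ ⟨k, rfl⟩ (Finset.mem_filter.1 hk).2.1
    linarith
  · rintro ε h0 h1 _ ⟨k, rfl⟩ _ ⟨l, rfl⟩ hkl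
    have hkl' := hf ⟨k, rfl⟩ ⟨l, rfl⟩ hkl
    dsimp only
    by_cases hl : X s ≤ X l ∧ X l ≤ X i
    · by_cases hk : X s ≤ X k
      · rw [if_pos hl, if_pos ⟨hk, hkl.trans hl.2⟩]
        linarith
      · rw [if_pos hl, if_neg fun h => hk h.1]
        have hne : f (X k) ≠ f (X j) := fun h => hk (hmin' k h)
        have hle : f (X j) ≤ f (X k) := hs ▸ hf ⟨k, rfl⟩ ⟨s, rfl⟩ (not_le.1 hk).le
        have hks : f (X l) ≤ f (X j) := hs ▸ hf ⟨s, rfl⟩ ⟨l, rfl⟩ hl.1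
        have := hgap k hne
        rw [abs_of_nonneg (by linarith)] at this
        linarith
    · rw [if_neg hl]
      split_ifs <;> linarith

theorem le_of_window_average_le {a b L N W : ℝ} (hL : 0 ≤ L) (hN : 0 < N) (hNW : N ≤ W)
    (h : W * a ≤ 2 * √(L * W) + 1 + W * b) : a ≤ b + (2 * √(L / N) + 1 / N) := by
  have hW : 0 < W := hN.trans_le hNW
  have h1 : √(L * W) = W * √(L / W) := by
    have : L * W = W ^ 2 * (L / W) := by field_simp
    rw [this, Real.sqrt_mul (by positivity), Real.sqrt_sq hW.le]
  have h2 : a ≤ b + (2 * √(L / W) + 1 / W) := by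
    have : W * a ≤ W * (b + (2 * √(L / W) + 1 / W)) := by
      rw [h1] at h
      have : W * (1 / W) = 1 := mul_one_div_cancel hW.ne'
      linarith
    exact le_of_mul_le_mul_left this hW
  have h3 : √(L / W) ≤ √(L / N) := Real.sqrt_le_sqrt (by gcongr)
  have h4 : 1 / W ≤ 1 / N := by gcongr
  linarith

theorem designCount_eq_card {n : ℕ} (X : Fin n → ℝ) (B : Set ℝ) [DecidablePred (· ∈ B)] :
    designCount X B = (Finset.univ.filter fun i => X i ∈ B).card := by
  rw [designCount, ← Set.ncard_coe_finset]
  congr 1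
  ext i
  simp

theorem exists_extremal_indices {n : ℕ} (X : Fin n → ℝ) {B : Set ℝ} (hB : 0 < designCount X B) :
    ∃ i j, X i ∈ B ∧ X j ∈ B ∧
      (∀ r s, X r ≤ X i → X j ≤ X s → designCount X B ≤ (window X r s).card) := by
  classical
  rw [designCount_eq_card] at hB ⊢
  obtain ⟨i, hi, hmin⟩ := Finset.exists_min_image _ X (Finset.card_pos.1 hB)
  obtain ⟨j, hj, hmax⟩ := Finset.exists_max_image _ X (Finset.card_pos.1 hB)
  refine ⟨i, j, (Finset.mem_filter.1 hi).2, (Finset.mem_filter.1 hj).2, fun r s hr hs => ?_⟩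
  refine Finset.card_le_card fun k hk => ?_
  simp only [window, Finset.mem_filter, Finset.mem_univ, true_and]
  exact ⟨hr.trans (hmin k hk), (hmax k hk).trans hs⟩

theorem HolderInCovariate.abs_sub_le {F : ℝ → ℝ → ℝ} {I J : Set ℝ} {α C₁ d : ℝ}
    (hH : HolderInCovariate F I J α C₁) (hα : 0 ≤ α) (hC₁ : 0 ≤ C₁) {w x y : ℝ} (hw : w ∈ I)
    (hx : x ∈ I) (hy : y ∈ J) (hd : |w - x| ≤ d) : |F w y - F x y| ≤ C₁ * d ^ α :=
  (hH w hw x hx y hy).trans (by gcongr)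

section

variable {𝒳 I J : Set ℝ} {F : ℝ → ℝ → ℝ} {n : ℕ} {X Y : Fin n → ℝ} {Fhat : ℝ → ℝ → ℝ}
  {α C₁ N δ : ℝ}

theorem deviation_responseLaw (hF : IsStochIsotonicFamily 𝒳 F) (hX : ∀ k, X k ∈ 𝒳)
    (A : Finset (Fin n)) (y : ℝ) :
    deviation (fun k => responseLaw hF (X k)) A (Set.Iic y) Y =
      ∑ k ∈ A, (if Y k ≤ y then (1 : ℝ) else 0) - ∑ k ∈ A, F (X k) y := by
  rw [deviation, Finset.sum_sub_distrib]
  simp only [responseLaw_real_Iic hF (hX _), Set.indicator_apply, Set.mem_Iic]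

theorem estimator_le (hF : IsStochIsotonicFamily 𝒳 F) (hX : ∀ k, X k ∈ 𝒳) (hI : I ⊆ 𝒳)
    (hest : IsMonotoneLSEstimator 𝒳 X Y Fhat) (hH : HolderInCovariate F I J α C₁)
    (hα : 0 ≤ α) (hC₁ : 0 ≤ C₁)
    (hclose : UniformlyClose (fun k => responseLaw hF (X k)) X Y) {x y q : ℝ} (hx : x ∈ I)
    (hy : y ∈ J) (hq : Set.Icc (q - δ) q ⊆ I) (hqx : q ≤ x) (hxq : x - δ ≤ q) (hN : 0 < N)
    (hcount : N ≤ designCount X (Set.Icc (q - δ) q)) :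
    Fhat x y ≤ F x y + C₁ * (2 * δ) ^ α + (2 * √(Real.log n / N) + 1 / N) := by
  obtain ⟨i, j, hi, hj, hcard⟩ := exists_extremal_indices X
    (B := Set.Icc (q - δ) q) (by exact_mod_cast hN.trans_le hcount)
  have hanti : AntitoneOn (fun x => Fhat x y) (Set.range X) :=
    (hest.antitone y).mono (Set.range_subset_iff.2 hX)
  obtain ⟨s, hjs, hs⟩ := exists_window_right hanti (hest.minimal y) i j
  have hW : N ≤ (window X i s).card := hcount.trans (by exact_mod_cast hcard i s le_rfl hjs)
  have hdev := (abs_le.1 (hclose i s y)).2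
  rw [deviation_responseLaw hF hX] at hdev
  have hsum : ∑ k ∈ window X i s, F (X k) y ≤ (window X i s).card * F (X i) y := by
    rw [← nsmul_eq_mul]
    exact Finset.sum_le_card_nsmul _ _ _ fun k hk =>
      hF.antitone y (hX i) (hX k) (Finset.mem_filter.1 hk).2.1
  have h1 := le_of_window_average_le (Real.log_natCast_nonneg n) hN hW
    (a := Fhat (X j) y) (b := F (X i) y) (by linarith)
  have h2 : Fhat x y ≤ Fhat (X j) y := hest.antitone y (hX j) (hI hx) (hj.2.trans hqx)
  have h3 := (abs_le.1 (hH.abs_sub_le hα hC₁ (hq hi) hx hy (d := 2 * δ)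
    (abs_le.2 ⟨by linarith [hi.1], by linarith [hi.1, hi.2]⟩))).2
  linarith

theorem le_estimator (hF : IsStochIsotonicFamily 𝒳 F) (hX : ∀ k, X k ∈ 𝒳) (hI : I ⊆ 𝒳)
    (hest : IsMonotoneLSEstimator 𝒳 X Y Fhat) (hH : HolderInCovariate F I J α C₁)
    (hα : 0 ≤ α) (hC₁ : 0 ≤ C₁)
    (hclose : UniformlyClose (fun k => responseLaw hF (X k)) X Y) {x y q : ℝ} (hx : x ∈ I)
    (hy : y ∈ J) (hq : Set.Icc q (q + δ) ⊆ I) (hqx : x ≤ q) (hxq : q ≤ x + δ) (hN : 0 < N)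
    (hcount : N ≤ designCount X (Set.Icc q (q + δ))) :
    F x y ≤ Fhat x y + C₁ * (2 * δ) ^ α + (2 * √(Real.log n / N) + 1 / N) := by
  obtain ⟨j, i, hj, hi, hcard⟩ := exists_extremal_indices X
    (B := Set.Icc q (q + δ)) (by exact_mod_cast hN.trans_le hcount)
  have hanti : AntitoneOn (fun x => Fhat x y) (Set.range X) :=
    (hest.antitone y).mono (Set.range_subset_iff.2 hX)
  obtain ⟨s, hjs, hs⟩ := exists_window_left hanti (hest.minimal y) i j
  have hW : N ≤ (window X s i).card := hcount.trans (by exact_mod_cast hcard s i hjs le_rfl)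
  have hdev := (abs_le.1 (hclose s i y)).1
  rw [deviation_responseLaw hF hX] at hdev
  have hsum : (window X s i).card * F (X i) y ≤ ∑ k ∈ window X s i, F (X k) y := by
    rw [← nsmul_eq_mul]
    exact Finset.card_nsmul_le_sum _ _ _ fun k hk =>
      hF.antitone y (hX k) (hX i) (Finset.mem_filter.1 hk).2.2
  have h1 := le_of_window_average_le (Real.log_natCast_nonneg n) hN hW
    (a := F (X i) y) (b := Fhat (X j) y) (by linarith)
  have h2 : Fhat (X j) y ≤ Fhat x y := hest.antitone y (hI hx) (hX j) (hqx.trans hj.1)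
  have h3 := (abs_le.1 (hH.abs_sub_le hα hC₁ (hq hi) hx hy (d := 2 * δ)
    (abs_le.2 ⟨by linarith [hi.1, hi.2], by linarith [hi.2]⟩))).1
  linarith

end

/-- Every set of reals has a countable subset that meets, for each `x` in the set, both
`[x - δ, x]` and `[x, x + δ]`. -/
theorem exists_countable_net (S : Set ℝ) {δ : ℝ} (hδ : 0 < δ) :
    ∃ D ⊆ S, D.Countable ∧ ∀ x ∈ S, (∃ q ∈ D, q ≤ x ∧ x - δ ≤ q) ∧ ∃ q ∈ D, x ≤ q ∧ q ≤ x + δ := by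
  obtain ⟨D₀, hD₀S, hD₀, hcl⟩ :=
    (TopologicalSpace.IsSeparable.of_separableSpace S).exists_countable_dense_subset
  have hL : {x ∈ S | ∀ z ∈ S, z ≤ x - δ ∨ x ≤ z}.Countable := by
    refine Set.PairwiseDisjoint.countable_of_Ioo (y := fun x => x + δ) ?_ fun x _ => by linarith
    intro x hx z hz hxz
    refine Set.disjoint_left.2 fun u hu hv => hxz ?_
    rcases hx.2 z hz.1 with h | h <;> rcases hz.2 x hx.1 with h' | h' <;>
      linarith [hu.1, hu.2, hv.1, hv.2]
  have hR : {x ∈ S | ∀ z ∈ S, z ≤ x ∨ x + δ ≤ z}.Countable := by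
    refine Set.PairwiseDisjoint.countable_of_Ioo (y := fun x => x + δ) ?_ fun x _ => by linarith
    intro x hx z hz hxz
    refine Set.disjoint_left.2 fun u hu hv => hxz ?_
    rcases hx.2 z hz.1 with h | h <;> rcases hz.2 x hx.1 with h' | h' <;>
      linarith [hu.1, hu.2, hv.1, hv.2]
  refine ⟨D₀ ∪ ({x ∈ S | ∀ z ∈ S, z ≤ x - δ ∨ x ≤ z} ∪ {x ∈ S | ∀ z ∈ S, z ≤ x ∨ x + δ ≤ z}),
    Set.union_subset hD₀S (Set.union_subset (Set.sep_subset _ _) (Set.sep_subset _ _)),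
    hD₀.union (hL.union hR), fun x hx => ⟨?_, ?_⟩⟩
  · by_cases h : ∀ z ∈ S, z ≤ x - δ ∨ x ≤ z
    · exact ⟨x, Or.inr (Or.inl ⟨hx, h⟩), le_rfl, by linarith⟩
    · push Not at h
      obtain ⟨z, hz, h1, h2⟩ := h
      obtain ⟨q, hq, hqD⟩ := mem_closure_iff.1 (hcl hz) _ isOpen_Ioo ⟨h1, h2⟩
      exact ⟨q, Or.inl hqD, hq.2.le, hq.1.le⟩
  · by_cases h : ∀ z ∈ S, z ≤ x ∨ x + δ ≤ z
    · exact ⟨x, Or.inr (Or.inr ⟨hx, h⟩), le_rfl, by linarith⟩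
    · push Not at h
      obtain ⟨z, hz, h1, h2⟩ := h
      obtain ⟨q, hq, hqD⟩ := mem_closure_iff.1 (hcl hz) _ isOpen_Ioo ⟨h1, h2⟩
      exact ⟨q, Or.inl hqD, hq.1.le, hq.2.le⟩

theorem DenseDesign.le_designCount {n : ℕ} (hn : 1 ≤ n) {X : Fin n → ℝ} {I : Set ℝ} {C₂ δ a b : ℝ}
    (h : DenseDesign X I C₂ δ) (hδ : 0 < δ) (hab : b - a = δ) (hI : Set.Icc a b ⊆ I) :
    C₂ * (n * δ) ≤ designCount X (Set.Icc a b) := by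
  have hvol : volume (Set.Icc a b) = ENNReal.ofReal δ := by rw [Real.volume_Icc, hab]
  have h1 := h _ Set.ordConnected_Icc hI hvol.ge
  have hn' : (0 : ℝ) < n := by exact_mod_cast hn
  rw [hvol, ← ENNReal.ofReal_natCast n, ← ENNReal.ofReal_mul hn'.le,
    ← ENNReal.ofReal_natCast (designCount X _),
    ← ENNReal.ofReal_div_of_pos (by positivity),
    ENNReal.ofReal_le_ofReal_iff (by positivity)] at h1
  rwa [le_div_iff₀ (by positivity)] at h1

theorem measurable_designCount {Ω : Type*} [MeasurableSpace Ω] {n : ℕ} {X : Fin n → Ω → ℝ}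
    (hX : ∀ i, Measurable (X i)) {B : Set ℝ} (hB : MeasurableSet B) :
    Measurable fun ω => (designCount (fun i => X i ω) B : ℝ) := by
  classical
  simp only [designCount_eq_card, Finset.card_filter, Nat.cast_sum]
  refine Finset.measurable_sum _ fun k _ => ?_
  exact (measurable_from_top (f := fun m : ℕ => (m : ℝ))).comp
    (Measurable.ite (hX k hB) measurable_const measurable_const)

/-- The design is dense next to every point of `shrunkInterval I δ`, outside an event whose
probability is controlled by the one of `DenseDesign`. -/
theorem exists_dense_event {Ω : Type*} [MeasurableSpace Ω] {P : Measure Ω} [IsProbabilityMeasure P]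
    {n : ℕ} (hn : 1 ≤ n) {X : Fin n → Ω → ℝ} (hX : ∀ i, Measurable (X i)) (I : Set ℝ) (C₂ : ℝ)
    {δ : ℝ} (hδ : 0 < δ) :
    ∃ E : Set Ω, P Eᶜ ≤ 1 - P {ω | DenseDesign (fun i => X i ω) I C₂ δ} ∧
      ∀ ω ∈ E, ∀ x ∈ shrunkInterval I δ,
        (∃ q ∈ shrunkInterval I δ, q ≤ x ∧ x - δ ≤ q ∧
          C₂ * (n * δ) ≤ designCount (fun i => X i ω) (Set.Icc (q - δ) q)) ∧
        ∃ q ∈ shrunkInterval I δ, x ≤ q ∧ q ≤ x + δ ∧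
          C₂ * (n * δ) ≤ designCount (fun i => X i ω) (Set.Icc q (q + δ)) := by
  obtain ⟨D, hDS, hD, hnet⟩ := exists_countable_net (shrunkInterval I δ) hδ
  refine ⟨⋂ q ∈ D, ({ω | C₂ * (n * δ) ≤ designCount (fun i => X i ω) (Set.Icc (q - δ) q)} ∩
    {ω | C₂ * (n * δ) ≤ designCount (fun i => X i ω) (Set.Icc q (q + δ))}), ?_, ?_⟩
  · rw [prob_compl_eq_one_sub (MeasurableSet.biInter hD fun q _ =>
      (measurableSet_le measurable_const (measurable_designCount hX measurableSet_Icc)).inter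
        (measurableSet_le measurable_const (measurable_designCount hX measurableSet_Icc)))]
    refine tsub_le_tsub_left (measure_mono fun ω hω => ?_) _
    simp only [Set.mem_iInter]
    exact fun q hq =>
      ⟨DenseDesign.le_designCount hn hω hδ (by ring)
        ((Set.Icc_subset_Icc le_rfl (by linarith)).trans (hDS hq)),
      DenseDesign.le_designCount hn hω hδ (by ring)
        ((Set.Icc_subset_Icc (by linarith) le_rfl).trans (hDS hq))⟩
  · intro ω hω x hx
    simp only [Set.mem_iInter] at hω
    obtain ⟨⟨q, hq, h1, h2⟩, q', hq', h1', h2'⟩ := hnet x hx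
    exact ⟨⟨q, hDS hq, h1, h2, (hω q hq).1⟩, q', hDS hq', h1', h2', (hω q' hq').2⟩

theorem tendsto_deviation_bound :
    Tendsto (fun n : ℕ => ENNReal.ofReal (n * n * (4 * (n + 1) * Real.exp (-(8 * Real.log n)))))
      atTop (𝓝 0) := by
  rw [← ENNReal.ofReal_zero]
  refine ENNReal.tendsto_ofReal ?_
  have h8 : Tendsto (fun n : ℕ => (8 : ℝ) / n) atTop (𝓝 0) :=
    tendsto_const_div_atTop_nhds_zero_nat 8
  refine squeeze_zero' (Eventually.of_forall fun n => by positivity) ?_ h8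
  filter_upwards [eventually_ge_atTop 1] with n hn
  have h1 : (1 : ℝ) ≤ n := by exact_mod_cast hn
  have hexp : Real.exp (-(8 * Real.log n)) = ((n : ℝ) ^ 8)⁻¹ := by
    rw [Real.exp_neg, ← Real.exp_log (by positivity : (0 : ℝ) < n ^ 8), Real.log_pow]
    norm_num
  rw [hexp, ← div_eq_mul_inv, ← mul_div_assoc, div_le_div_iff₀ (by positivity) (by positivity)]
  calc (n : ℝ) * n * (4 * (n + 1)) * n ≤ n * n * (4 * (n + n)) * n := by gcongr
    _ = 8 * n ^ 4 := by ring
    _ ≤ 8 * n ^ 8 := by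
        gcongr
        · norm_num

theorem error_bound_le {C₁ C₂ C₃ α : ℝ} (hC₁ : 0 < C₁) (hC₂ : 0 < C₂) (hC₃ : 0 < C₃) (hα : 0 < α)
    (hα1 : α ≤ 1) {n : ℕ} (hn : 3 ≤ n) :
    C₁ * (2 * delta C₃ α n) ^ α + (2 * √(Real.log n / (C₂ * (n * delta C₃ α n))) +
        1 / (C₂ * (n * delta C₃ α n))) ≤
      (C₁ * (1 + 2 * C₃) + 2 / √(C₂ * C₃) + 1 / (C₂ * C₃)) * rho n ^ (α / (2 * α + 1)) := by
  have hn0 : (0 : ℝ) < n := by positivity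
  have hlog : 1 ≤ Real.log n := by
    rw [Real.le_log_iff_exp_le hn0]
    exact Real.exp_one_lt_d9.le.trans (by
      have : (3 : ℝ) ≤ n := by exact_mod_cast hn
      linarith)
  have hρ : 0 < rho n := div_pos (by linarith) hn0
  have hρ1 : rho n ≤ 1 := by
    rw [rho, div_le_one hn0]
    linarith [Real.log_le_sub_one_of_pos hn0]
  set r := rho n ^ (α / (2 * α + 1)) with hr
  set d := rho n ^ (1 / (2 * α + 1)) with hd
  have hr0 : 0 < r := Real.rpow_pos_of_pos hρ _
  have hd0 : 0 < d := Real.rpow_pos_of_pos hρ _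
  have hr1 : r ≤ 1 := Real.rpow_le_one hρ.le hρ1 (by positivity)
  have hdα : d ^ α = r := by
    rw [hd, hr, ← Real.rpow_mul hρ.le]
    congr 1
    ring
  have hrd : r ^ 2 * d = rho n := by
    rw [hd, hr, ← Real.rpow_natCast, ← Real.rpow_mul hρ.le, ← Real.rpow_add hρ]
    have : α / (2 * α + 1) * (2 : ℕ) + 1 / (2 * α + 1) = 1 := by
      push_cast
      field_simp
    rw [this, Real.rpow_one]
  have hδ : delta C₃ α n = C₃ * d := rfl
  have hlogn : Real.log n = r ^ 2 * d * n := by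
    rw [hrd, rho]
    field_simp
  have hquot : Real.log n / (C₂ * (n * delta C₃ α n)) = r ^ 2 / (C₂ * C₃) := by
    rw [hδ, hlogn]
    field_simp
  have h1 : (2 * delta C₃ α n) ^ α ≤ (1 + 2 * C₃) * r := by
    rw [hδ, ← mul_assoc, Real.mul_rpow (by positivity) hd0.le, hdα]
    gcongr
    calc (2 * C₃) ^ α ≤ (1 + 2 * C₃) ^ α := by gcongr; linarith
      _ ≤ (1 + 2 * C₃) ^ (1 : ℝ) := Real.rpow_le_rpow_of_exponent_le (by linarith) hα1
      _ = 1 + 2 * C₃ := Real.rpow_one _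
  have h2 : √(Real.log n / (C₂ * (n * delta C₃ α n))) = r / √(C₂ * C₃) := by
    rw [hquot, Real.sqrt_div (by positivity), Real.sqrt_sq hr0.le]
  have h3 : 1 / (C₂ * (n * delta C₃ α n)) ≤ r / (C₂ * C₃) := by
    calc 1 / (C₂ * (n * delta C₃ α n)) ≤ Real.log n / (C₂ * (n * delta C₃ α n)) := by
          have : 0 < delta C₃ α n := by rw [hδ]; positivity
          gcongr
      _ = r ^ 2 / (C₂ * C₃) := hquot
      _ ≤ r / (C₂ * C₃) := by
          gcongr
          nlinarith
  rw [h2]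
  calc C₁ * (2 * delta C₃ α n) ^ α + (2 * (r / √(C₂ * C₃)) + 1 / (C₂ * (n * delta C₃ α n)))
      ≤ C₁ * ((1 + 2 * C₃) * r) + (2 * (r / √(C₂ * C₃)) + r / (C₂ * C₃)) := by gcongr
    _ = _ := by ring

end MonotoneLS

theorem theorem1 (C₁ C₂ C₃ : ℝ) (hC₁ : 0 < C₁) (hC₂ : 0 < C₂) (hC₃ : 0 < C₃) :
    ∃ C : ℝ, 0 < C ∧
      ∀ (α : ℝ), 0 < α → α ≤ 1 →
      ∀ (𝒳 I J : Set ℝ), 𝒳.OrdConnected → I.OrdConnected → J.OrdConnected → I ⊆ 𝒳 →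
      ∀ (F : ℝ → ℝ → ℝ), MonotoneLS.IsStochIsotonicFamily 𝒳 F →
      ∀ (Ω : ℕ → Type*) [∀ n, MeasurableSpace (Ω n)] (P : ∀ n, Measure (Ω n))
        [∀ n, IsProbabilityMeasure (P n)] (X Y : ∀ n, Fin n → Ω n → ℝ),
      (∀ n, 2 ≤ n → MonotoneLS.IsSample (P n) 𝒳 F (X n) (Y n)) →
      ∀ (Fhat : ∀ n, Ω n → ℝ → ℝ → ℝ),
      (∀ n, 2 ≤ n → ∀ ω, MonotoneLS.IsMonotoneLSEstimator 𝒳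
        (fun i => X n i ω) (fun i => Y n i ω) (Fhat n ω)) →
      MonotoneLS.HolderInCovariate F I J α C₁ →
      Tendsto (fun n => P n {ω | MonotoneLS.DenseDesign (fun i => X n i ω) I C₂
        (MonotoneLS.delta C₃ α n)}) atTop (𝓝 1) →
      Tendsto (fun n => P n {ω |
          ENNReal.ofReal (C * MonotoneLS.rho n ^ (α / (2 * α + 1))) ≤
            ⨆ x ∈ MonotoneLS.shrunkInterval I (MonotoneLS.delta C₃ α n), ⨆ y ∈ J,
              ENNReal.ofReal |Fhat n ω x y - F x y|})
        atTop (𝓝 0) := by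
  refine ⟨C₁ * (1 + 2 * C₃) + 2 / √(C₂ * C₃) + 1 / (C₂ * C₃) + 1, by positivity, ?_⟩
  intro α hα hα1 𝒳 I J h𝒳 _ _ hI F hF Ω _ P _ X Y hS Fhat hest hH hdense
  have hlim : Tendsto (fun n => (1 - P n {ω | MonotoneLS.DenseDesign (fun i => X n i ω) I C₂
      (MonotoneLS.delta C₃ α n)}) +
        ENNReal.ofReal (n * n * (4 * (n + 1) * Real.exp (-(8 * Real.log n))))) atTop (𝓝 0) := by
    have h1 := ENNReal.Tendsto.sub (tendsto_const_nhds (x := (1 : ℝ≥0∞))) hdense (by simp)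
    simpa using h1.add MonotoneLS.tendsto_deviation_bound
  refine tendsto_of_tendsto_of_tendsto_of_le_of_le' tendsto_const_nhds hlim
    (Eventually.of_forall fun _ => zero_le) ?_
  filter_upwards [eventually_ge_atTop 3] with n hn
  have hn0 : (0 : ℝ) < n := by positivity
  have hρ : 0 < MonotoneLS.rho n := div_pos (Real.log_pos (by exact_mod_cast (by omega : 1 < n))) hn0
  have hδ : 0 < MonotoneLS.delta C₃ α n := mul_pos hC₃ (Real.rpow_pos_of_pos hρ _)
  have hSn := hS n (by omega)
  obtain ⟨E, hE, hEω⟩ := MonotoneLS.exists_dense_event (P := P n) (by omega) hSn.measurable_X I C₂ hδ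
  refine (measure_mono (fun ω hω => ?_)).trans ((measure_union_le _ _).trans
    (add_le_add hE (hSn.measure_not_uniformlyClose_le hF h𝒳 (by omega))))
  by_contra hcon
  simp only [Set.mem_union, Set.mem_compl_iff, Set.mem_ofPred_eq, not_or, not_not] at hcon
  refine absurd hω (not_le.2 (lt_of_le_of_lt (b := ENNReal.ofReal
    ((C₁ * (1 + 2 * C₃) + 2 / √(C₂ * C₃) + 1 / (C₂ * C₃)) *
      MonotoneLS.rho n ^ (α / (2 * α + 1)))) ?_ ?_))
  · refine iSup₂_le fun x hx => iSup₂_le fun y hy => ENNReal.ofReal_le_ofReal ?_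
    refine le_trans ?_ (MonotoneLS.error_bound_le hC₁ hC₂ hC₃ hα hα1 hn)
    obtain ⟨⟨q, hq, hqx, hxq, hc⟩, q', hq', hqx', hxq', hc'⟩ := hEω ω hcon.1 x hx
    have hxI : x ∈ I := hx ⟨by linarith, by linarith⟩
    have hN : 0 < C₂ * (n * MonotoneLS.delta C₃ α n) := by positivity
    have hu := MonotoneLS.estimator_le hF (fun k => hSn.mem k ω) hI (hest n (by omega) ω) hH hα.le
      hC₁.le hcon.2 hxI hy ((Set.Icc_subset_Icc le_rfl (by linarith)).trans hq) hqx hxq hN hc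
    have hl := MonotoneLS.le_estimator hF (fun k => hSn.mem k ω) hI (hest n (by omega) ω) hH hα.le
      hC₁.le hcon.2 hxI hy ((Set.Icc_subset_Icc (by linarith) le_rfl).trans hq') hqx' hxq' hN hc'
    exact abs_le.2 ⟨by linarith, by linarith⟩
  · have hr : 0 < MonotoneLS.rho n ^ (α / (2 * α + 1)) := Real.rpow_pos_of_pos hρ _
    refine (ENNReal.ofReal_lt_ofReal_iff (by positivity)).2 ?_
    linarith
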